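/- Let $I\subseteq\mathbb R$ be an interval (bounded or not) and let $\mathfrak F=\bigoplus_{n\ge 0}\mathfrak F_n$ be the bosonic Fock space over $L^2(I)$, where $\mathfrak F_n\subset L^2(I^n)$ is the subspace of symmetric wavefunctions, with vacuum $|\Omega\rangle$ and field $(\psi(x)\Phi)_n(y_1,\dots,y_n)=\sqrt{n+1}\,\Phi_{n+1}(x,y_1,\dots,y_n)$; $\psi^\dagger(x)$ is the adjoint, in the sense of matrix elements. For a generator $\mathfrak L_x$, $x\in I$, and $B\in M_D(\mathbb C)$ let $$\mathrm{Tr}_D\Bigl(B\,\mathcal P e^{\int_I \mathrm dx\,\mathfrak L_x}\Bigr)=\sum_{n=0}^\infty\ \int_{x_1<\dots<x_n,\ x_k\in I}\mathrm{Tr}_D\bigl(B\,\mathfrak L_{x_1}\mathfrak L_{x_2}\cdots\mathfrak L_{x_n}\bigr)\,\mathrm dx_1\cdots \mathrm dx_n ,$$ the integrals and the series being understood as absolutely convergent in matrix elements with (between) finite-particle vectors. * A vector $|\psi\rangle\in\mathfrak F$ is the cMPS with bond dimension $D$ and tensors $B\in M_D(\mathbb C)$, $Q,L:I\to M_D(\mathbb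 C)$ if $|\psi\rangle=\mathrm{Tr}_D\bigl(B\,\mathcal P e^{\int_I \mathrm dx\,Q(x)\otimes 1+L(x)\otimes\psi^\dagger(x)}\bigr)|\Omega\rangle$. * A bounded operator $O$ on $\mathfrak F$ is the cMPO with bond dimension $D$ and tensors $B\in M_D(\mathbb C)$, $Q,L,R,T:I\to M_D(\mathbb C)$ if $O=\mathrm{Tr}_D\bigl(B\,\mathcal P e^{\int_I \mathrm dx\,\mathfrak L_x}\bigr)[\,|\Omega\rangle\langle\Omega|\,]$ with $\mathfrak L_x=Q(x)\otimes\mathrm{Id}+L(x)\otimes l_x+R(x)\otimes r_x+T(x)\otimes\mathrm{Ad}_x$, where $l_x[K]=\psi^\dagger(x)K$, $r_x[K]=K\psi(x)$ and $\mathrm{Ad}_x[K]=\psi^\dagger(x)K\psi(x)$. **Proposition.** Let $|\psi_i\rangle,|\psi_j\rangle\in\mathfrak F$ be two normalized cMPS with tensors $(B_i,Q_i,L_i)$, $(B_j,Q_j,L_j)$ and bond dimensions $D_i$, $D_j$. Then $|\psi_i\rangle\langle\psi_j|$ is a cMPO with bond dimension $D_iD_j$. Moreover, it is the cMPO with the tensors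 $$B=B_i\otimes B_j^*,\quad Q(x)=Q_i(x)\otimes 1_{D_j}+1_{D_i}\otimes Q_j(x)^*,\quad L(x)=L_i(x)\otimes 1_{D_j},\quad R(x)=1_{D_i}\otimes L_j(x)^*,\quad T(x)=0,$$ where $*$ is the entrywise complex conjugate. In particular, the orthogonal projector onto the line spanned by a normalized cMPS with bond dimension $D$ is a cMPO with bond dimension $D^2$. -/

import Mathlib

open MeasureTheory
open scoped Kronecker ENNReal

noncomputable section

namespace ContinuousMPO

/-! ### Bosonic Fock space over `L²(I)` -/

/-- The measure on configurations of `n` points of `I`: the `n`-fold product of Lebesgue measure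
on `I`. -/
abbrev configMeasure (I : Set ℝ) (n : ℕ) : Measure (Fin n → ℝ) :=
  Measure.pi fun _ : Fin n => volume.restrict I

/-- Permuting the `n` coordinates preserves the measure on configurations. -/
theorem measurePreserving_permute (I : Set ℝ) {n : ℕ} (σ : Equiv.Perm (Fin n)) :
    MeasurePreserving (fun x : Fin n → ℝ => x ∘ σ) (configMeasure I n) (configMeasure I n) := by
  have h := measurePreserving_piCongrLeft
    (fun _ : Fin n => (volume.restrict I : Measure ℝ)) σ⁻¹
  convert h using 1
  funext x
  funext k
  obtain ⟨m, rfl⟩ := (σ⁻¹).surjective k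
  rw [MeasurableEquiv.piCongrLeft, MeasurableEquiv.coe_mk, Equiv.piCongrLeft_apply_apply]
  simp

/-- The `n`-particle sector: the square-integrable wavefunctions on `I ^ n` that are invariant
under all permutations of the coordinates. -/
def sector (I : Set ℝ) (n : ℕ) : Submodule ℂ (Lp ℂ 2 (configMeasure I n)) :=
  ⨅ σ : Equiv.Perm (Fin n),
    LinearMap.eqLocus
      (Lp.compMeasurePreservingₗ ℂ (fun x : Fin n → ℝ => x ∘ σ) (measurePreserving_permute I σ))
      LinearMap.id

/-- Each sector is a closed subspace, hence a Hilbert space, and so is the Fock space below. -/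
instance instCompleteSpaceSector (I : Set ℝ) (n : ℕ) : CompleteSpace (sector I n) := by
  have h : IsClosed (sector I n : Set (Lp ℂ 2 (configMeasure I n))) := by
    unfold sector
    rw [Submodule.coe_iInf]
    exact isClosed_iInter fun σ => isClosed_eq
      (Lp.compMeasurePreservingₗᵢ ℂ _ (measurePreserving_permute I σ)).continuous continuous_id
  exact h.completeSpace_coe

/-- The bosonic Fock space over `L²(I)`, the Hilbert sum of the `n`-particle sectors. -/
abbrev Fock (I : Set ℝ) : Type := lp (fun n : ℕ => sector I n) 2

instance instHasOrthogonalProjectionSpan (I : Set ℝ) (ψ : Fock I) :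
    (Submodule.span ℂ {ψ}).HasOrthogonalProjection :=
  haveI : FiniteDimensional ℂ (Submodule.span ℂ {ψ}) := inferInstance
  haveI := FiniteDimensional.complete ℂ (Submodule.span ℂ {ψ})
  Submodule.HasOrthogonalProjection.ofCompleteSpace _

/-- A sequence of `n`-particle wavefunctions. -/
abbrev Wave : Type := (n : ℕ) → (Fin n → ℝ) → ℂ

/-- The wavefunctions of a vector of Fock space. -/
def wave {I : Set ℝ} (Φ : Fock I) : Wave := fun n x => (Φ n : Lp ℂ 2 (configMeasure I n)) x

/-- Vectors with finitely many particles: almost all sectors vanish. -/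
def FiniteParticle {I : Set ℝ} (Φ : Fock I) : Prop := ∃ N : ℕ, ∀ n, N < n → Φ n = 0

/-! ### The field

The annihilation field `ψ(x)` acts on wavefunctions by evaluation. The creation field `ψ†(x)` is
its adjoint; it only makes sense in matrix elements, so that generalized states such as
`ψ†(x₁) ⋯ ψ†(xₙ)|Ω⟩` are represented by their overlaps `⟨Φ|v⟩`, and generalized operators such as
`ψ†(x)|Ω⟩⟨Ω|ψ(y)` by their matrix elements `⟨Φ|K|Χ⟩`. -/

/-- The field operator: `(ψ(x) φ)ₙ(y₁, …, yₙ) = √(n + 1) φₙ₊₁(x, y₁, …, yₙ)`. -/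
def annihilate (x : ℝ) (φ : Wave) : Wave :=
  fun n y => (Real.sqrt (n + 1) : ℂ) * φ (n + 1) (Fin.cons x y)

/-- A generalized state `v`, given by `Φ ↦ ⟨Φ|v⟩`. -/
abbrev Ket : Type := Wave → ℂ

/-- The vacuum `|Ω⟩`. -/
def vacuumKet : Ket := fun Φ => star (Φ 0 ![])

/-- `v ↦ ψ†(x) v`, where `⟨Φ|ψ†(x) v⟩ = ⟨ψ(x) Φ|v⟩`. -/
def create (x : ℝ) : Module.End ℂ Ket where
  toFun v := fun Φ => v (annihilate x Φ)
  map_add' _ _ := rfl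
  map_smul' _ _ := rfl

/-- A generalized operator `K`, given by `Φ, Χ ↦ ⟨Φ|K|Χ⟩`. -/
abbrev FormOp : Type := Wave → Wave → ℂ

/-- The vacuum projector `|Ω⟩⟨Ω|`. -/
def vacuumProj : FormOp := fun Φ Χ => star (Φ 0 ![]) * Χ 0 ![]

/-- The left multiplication `l_x : K ↦ ψ†(x) K`. -/
def leftMap (x : ℝ) : Module.End ℂ FormOp where
  toFun K := fun Φ Χ => K (annihilate x Φ) Χ
  map_add' _ _ := rfl
  map_smul' _ _ := rfl

/-- The right multiplication `r_x : K ↦ K ψ(x)`. -/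
def rightMap (x : ℝ) : Module.End ℂ FormOp where
  toFun K := fun Φ Χ => K Φ (annihilate x Χ)
  map_add' _ _ := rfl
  map_smul' _ _ := rfl

/-- The two-sided multiplication `Ad_x : K ↦ ψ†(x) K ψ(x)`. -/
def adMap (x : ℝ) : Module.End ℂ FormOp where
  toFun K := fun Φ Χ => K (annihilate x Φ) (annihilate x Χ)
  map_add' _ _ := rfl
  map_smul' _ _ := rfl

/-! ### Path-ordered exponentials -/

/-- The ordered simplex `x₁ < x₂ < ⋯ < xₙ`. -/
def orderedSimplex (n : ℕ) : Set (Fin n → ℝ) := {x | StrictMono x}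

/-- `Tr(B M)`, the trace over the auxiliary space, for a matrix `M` of linear maps of `V`. -/
def auxTrace {ι V : Type} [Fintype ι] [AddCommGroup V] [Module ℂ V]
    (B : Matrix ι ι ℂ) (M : Matrix ι ι (Module.End ℂ V)) : Module.End ℂ V :=
  ∑ a, ∑ b, B a b • M b a

/-- The ordered product `𝔏(x₁) 𝔏(x₂) ⋯ 𝔏(xₙ)`. -/
def orderedProduct {ι V : Type} [Fintype ι] [DecidableEq ι] [AddCommGroup V] [Module ℂ V]
    (𝔏 : ℝ → Matrix ι ι (Module.End ℂ V)) {n : ℕ} (x : Fin n → ℝ) :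
    Matrix ι ι (Module.End ℂ V) :=
  (List.ofFn fun k => 𝔏 (x k)).prod

/-- The path-ordered exponential applied to `v` and traced against `B`: the complex number `z` is
the value under `ev` (a matrix element) of
`Tr(B 𝒫exp ∫_I 𝔏(x) dx)[v] = ∑ₙ ∫_{x₁ < ⋯ < xₙ in I} Tr(B 𝔏(x₁) ⋯ 𝔏(xₙ))[v] dx`,
where each integral and the series converge absolutely. -/
def HasPathExp {ι V : Type} [Fintype ι] [DecidableEq ι] [AddCommGroup V] [Module ℂ V]
    (I : Set ℝ) (B : Matrix ι ι ℂ) (𝔏 : ℝ → Matrix ι ι (Module.End ℂ V)) (v : V)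
    (ev : V → ℂ) (z : ℂ) : Prop :=
  (∀ n : ℕ, IntegrableOn (fun x : Fin n → ℝ => ev (auxTrace B (orderedProduct 𝔏 x) v))
      (orderedSimplex n) (configMeasure I n)) ∧
  HasSum (fun n : ℕ => ∫ x in orderedSimplex n, ev (auxTrace B (orderedProduct 𝔏 x) v)
      ∂(configMeasure I n)) z

/-! ### Continuous matrix product states and operators -/

/-- `Q(x) ⊗ 1 + L(x) ⊗ ψ†(x)`. -/
def stateGenerator {ι : Type} (Q L : ℝ → Matrix ι ι ℂ) (x : ℝ) :
    Matrix ι ι (Module.End ℂ Ket) :=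
  Matrix.of fun a b => Q x a b • (1 : Module.End ℂ Ket) + L x a b • create x

/-- `Q(x) ⊗ Id + L(x) ⊗ l_x + R(x) ⊗ r_x + T(x) ⊗ Ad_x`. -/
def operatorGenerator {ι : Type} (Q L R T : ℝ → Matrix ι ι ℂ) (x : ℝ) :
    Matrix ι ι (Module.End ℂ FormOp) :=
  Matrix.of fun a b => Q x a b • (1 : Module.End ℂ FormOp) + L x a b • leftMap x
    + R x a b • rightMap x + T x a b • adMap x

/-- The vector `ψ` of Fock space is the cMPS `|ψ[B, Q, L]⟩ = Tr(B 𝒫exp ∫_I Q ⊗ 1 + L ⊗ ψ†)|Ω⟩`;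
the equality is that of the overlaps with all finite-particle vectors, which are dense. -/
def IsCMPSWith {ι : Type} [Fintype ι] [DecidableEq ι] (I : Set ℝ)
    (B : Matrix ι ι ℂ) (Q L : ℝ → Matrix ι ι ℂ) (ψ : Fock I) : Prop :=
  ∀ Φ : Fock I, FiniteParticle Φ →
    HasPathExp I B (stateGenerator Q L) vacuumKet (fun v => v (wave Φ)) (inner ℂ Φ ψ)

/-- The bounded operator `O` on Fock space is the cMPO
`O[B, Q, L, R, T] = Tr(B 𝒫exp ∫_I Q ⊗ Id + L ⊗ l_x + R ⊗ r_x + T ⊗ Ad_x)[|Ω⟩⟨Ω|]`; the equality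
is that of the matrix elements between all finite-particle vectors, which are dense. -/
def IsCMPOWith {ι : Type} [Fintype ι] [DecidableEq ι] (I : Set ℝ)
    (B : Matrix ι ι ℂ) (Q L R T : ℝ → Matrix ι ι ℂ) (O : Fock I →L[ℂ] Fock I) : Prop :=
  ∀ Φ Χ : Fock I, FiniteParticle Φ → FiniteParticle Χ →
    HasPathExp I B (operatorGenerator Q L R T) vacuumProj (fun K => K (wave Φ) (wave Χ))
      (inner ℂ Φ (O Χ))

/-- `O` is a cMPO with bond dimension `D`. -/
def IsCMPO (I : Set ℝ) (D : ℕ) (O : Fock I →L[ℂ] Fock I) : Prop :=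
  ∃ (B : Matrix (Fin D) (Fin D) ℂ) (Q L R T : ℝ → Matrix (Fin D) (Fin D) ℂ),
    IsCMPOWith I B Q L R T O

end ContinuousMPO

end

noncomputable section

namespace ContinuousMPO

/-! ### Integrals over unordered configurations -/

/-! Since `T = 0`, the generator at `x` is a sum of two pieces, one acting on the ket of `|v⟩⟨w|`
and one on the bra. Expanding the ordered product over a finite set `s` of points, each point goes
either to the ket or to the bra, and the order inside each group is kept. So the integrand is the
sum over `t ⊆ s` of `F t * G (s \ t)`, where `F` is the integrand of `⟨Φ|ψi⟩` and `G` the conjugate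
of that of `⟨Χ|ψj⟩` (`pathProduct_ketBraGenerator`, `auxTrace_ketBraGenerator`).

A function of the point set is symmetric, so its simplex integral is `1 / n!` times its integral
over all configurations. There Fubini separates the two groups, and the factorials turn the
convolution `splitSum` into a Cauchy product of simplex integrals
(`integral_orderedSimplex_splitSum`). Absolute convergence then gives `⟨Φ|ψi⟩⟨ψj|Χ⟩`. -/

/-- The set of points of a configuration. -/
def points {ι : Type*} [Fintype ι] (x : ι → ℝ) : Finset ℝ := Finset.univ.image x

theorem points_comp_equiv {ι κ : Type*} [Fintype ι] [Fintype κ] (x : ι → ℝ) (e : κ ≃ ι) :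
    points (x ∘ e) = points x := by
  ext a
  simp [points, e.surjective.exists]

@[simp]
theorem points_permute {n : ℕ} (x : Fin n → ℝ) (σ : Equiv.Perm (Fin n)) :
    points (fun i => x (σ i)) = points x := points_comp_equiv x σ

theorem points_comp_orderEmbOfFin {n k : ℕ} (x : Fin n → ℝ) (A : Finset (Fin n))
    (h : A.card = k) : points (x ∘ A.orderEmbOfFin h) = A.image x := by
  rw [points, ← Finset.image_image, Finset.image_orderEmbOfFin_univ]

theorem sort_points_of_strictMono {n : ℕ} {x : Fin n → ℝ} (hx : StrictMono x) :
    (points x).sort = List.ofFn x := by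
  have h : (List.ofFn x).SortedLT := List.sortedLT_ofFn_iff.2 hx
  have h' : points x = (List.ofFn x).toFinset := by
    ext a
    simp [points, List.mem_ofFn]
  rw [h', List.toFinset_sort _ (List.nodup_ofFn.2 hx.injective)]
  exact h.sortedLE.pairwise

/-- A coincidence `x i = x j` is the kernel of a nonzero linear form, hence Lebesgue-null. -/
theorem ae_injective (I : Set ℝ) (n : ℕ) :
    ∀ᵐ x ∂configMeasure I n, Function.Injective x := by
  have h : ∀ i j : Fin n, i ≠ j → ∀ᵐ x ∂configMeasure I n, x i ≠ x j := by
    intro i j hij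
    rw [configMeasure, ← Measure.restrict_pi_pi]
    refine ae_restrict_of_ae ?_
    let f : (Fin n → ℝ) →ₗ[ℝ] ℝ := LinearMap.proj (R := ℝ) (φ := fun _ => ℝ) i - LinearMap.proj j
    have hf : LinearMap.ker f ≠ ⊤ := by
      intro h
      have h1 : Pi.single i (1 : ℝ) ∈ LinearMap.ker f := h ▸ Submodule.mem_top
      simp [f, hij.symm] at h1
    have h0 := Measure.addHaar_submodule (volume : Measure (Fin n → ℝ)) _ hf
    rw [ae_iff]
    refine measure_mono_null (fun x hx => ?_) h0
    simpa [f, sub_eq_zero] using hx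
  have h' := ae_all_iff.2 fun i => ae_all_iff.2 fun j => ae_all_iff.2 (h i j)
  filter_upwards [h'] with x hx i j hij
  by_contra hne
  exact hx i j hne hij

theorem measurableSet_orderedSimplex (n : ℕ) : MeasurableSet (orderedSimplex n) := by
  have h : orderedSimplex n =
      ⋂ (i : Fin n) (j : Fin n) (_ : i < j), {x : Fin n → ℝ | x i < x j} := by
    ext x
    simp only [orderedSimplex, Set.mem_ofPred_eq, Set.mem_iInter]
    exact ⟨fun h i j hij => h hij, fun h i j hij => h i j hij⟩
  rw [h]
  exact .iInter fun i => .iInter fun j => .iInter fun _ =>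
    measurableSet_lt (measurable_pi_apply i) (measurable_pi_apply j)

/-- The configurations that the permutation `σ` sorts strictly. -/
def sortedBy {n : ℕ} (σ : Equiv.Perm (Fin n)) : Set (Fin n → ℝ) :=
  (fun x => x ∘ σ) ⁻¹' orderedSimplex n

theorem measurableSet_sortedBy {n : ℕ} (σ : Equiv.Perm (Fin n)) :
    MeasurableSet (sortedBy σ) :=
  (measurableSet_orderedSimplex n).preimage
    (measurable_pi_lambda _ fun i => measurable_pi_apply (σ i))

theorem pairwise_disjoint_sortedBy (n : ℕ) :
    Pairwise (Function.onFun Disjoint (sortedBy : Equiv.Perm (Fin n) → Set (Fin n → ℝ))) := by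
  intro σ τ hne
  refine Set.disjoint_left.2 fun x hσ hτ => hne ?_
  have hσ : StrictMono (x ∘ σ) := hσ
  have hτ : StrictMono (x ∘ τ) := hτ
  have h := Tuple.unique_monotone hσ.monotone hτ.monotone
  have hx : Function.Injective x := by
    have := hσ.injective.comp σ.symm.injective
    simpa [Function.comp_assoc] using this
  ext i
  exact congrArg _ (hx (congrFun h i))

theorem iUnion_sortedBy_ae_eq_univ (I : Set ℝ) (n : ℕ) :
    (⋃ σ : Equiv.Perm (Fin n), sortedBy σ) =ᵐ[configMeasure I n] Set.univ := by
  rw [ae_eq_univ]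
  refine measure_mono_null (fun x hx => ?_) (ae_iff.1 (ae_injective I n))
  intro hinj
  exact hx (Set.mem_iUnion.2 ⟨Tuple.sort x,
    (Tuple.monotone_sort x).strictMono_of_injective (hinj.comp (Tuple.sort x).injective)⟩)

theorem measurableEmbedding_permute {n : ℕ} (σ : Equiv.Perm (Fin n)) :
    MeasurableEmbedding (fun x : Fin n → ℝ => x ∘ σ) := by
  have h : (fun x : Fin n → ℝ => x ∘ σ) =
      (MeasurableEquiv.piCongrLeft (fun _ : Fin n => ℝ) σ).symm := by
    funext x
    rfl
  rw [h]
  exact MeasurableEquiv.measurableEmbedding _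

theorem integrableOn_sortedBy {I : Set ℝ} {n : ℕ} {F : Finset ℝ → ℂ}
    (h : IntegrableOn (fun x : Fin n → ℝ => F (points x)) (orderedSimplex n) (configMeasure I n))
    (σ : Equiv.Perm (Fin n)) :
    IntegrableOn (fun x : Fin n → ℝ => F (points x)) (sortedBy σ) (configMeasure I n) := by
  have := ((measurePreserving_permute I σ).integrableOn_comp_preimage
    (measurableEmbedding_permute σ)).2 h
  simpa [Function.comp_def, sortedBy] using this

/-- Coordinate permutations carry the ordered simplex onto `n!` regions covering almost everything,
and the integrand does not see them. Fubini needs the unordered side. -/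
theorem integrable_points_iff {I : Set ℝ} {n : ℕ} {F : Finset ℝ → ℂ} :
    Integrable (fun x : Fin n → ℝ => F (points x)) (configMeasure I n) ↔
      IntegrableOn (fun x : Fin n → ℝ => F (points x)) (orderedSimplex n) (configMeasure I n) := by
  refine ⟨fun h => h.integrableOn, fun h => ?_⟩
  rw [← integrableOn_univ, ← integrableOn_congr_set_ae (iUnion_sortedBy_ae_eq_univ I n)]
  exact integrableOn_finite_iUnion.2 fun σ => integrableOn_sortedBy h σ

theorem integral_points_eq_factorial_mul {I : Set ℝ} {n : ℕ} {F : Finset ℝ → ℂ}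
    (h : Integrable (fun x : Fin n → ℝ => F (points x)) (configMeasure I n)) :
    ∫ x, F (points x) ∂configMeasure I n =
      n.factorial * ∫ x in orderedSimplex n, F (points x) ∂configMeasure I n := by
  rw [← setIntegral_univ, ← setIntegral_congr_set (iUnion_sortedBy_ae_eq_univ I n),
    integral_iUnion_fintype measurableSet_sortedBy (pairwise_disjoint_sortedBy n)
      fun σ => h.integrableOn]
  have hσ : ∀ σ : Equiv.Perm (Fin n), ∫ x in sortedBy σ, F (points x) ∂configMeasure I n =
      ∫ x in orderedSimplex n, F (points x) ∂configMeasure I n := by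
    intro σ
    have := (measurePreserving_permute I σ).setIntegral_preimage_emb
      (measurableEmbedding_permute σ) (fun x => F (points x)) (orderedSimplex n)
    simpa [Function.comp_def, sortedBy] using this
  simp [hσ, Fintype.card_perm]

/-- Splitting a configuration into two according to a splitting of the index set. -/
def splitEquiv {ι κ τ : Type*} (e : ι ⊕ κ ≃ τ) : (τ → ℝ) ≃ᵐ (ι → ℝ) × (κ → ℝ) :=
  (MeasurableEquiv.piCongrLeft (fun _ : τ => ℝ) e).symm.trans
    (MeasurableEquiv.sumPiEquivProdPi fun _ : ι ⊕ κ => ℝ)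

theorem splitEquiv_apply {ι κ τ : Type*} (e : ι ⊕ κ ≃ τ) (x : τ → ℝ) :
    splitEquiv e x = (x ∘ e ∘ Sum.inl, x ∘ e ∘ Sum.inr) := rfl

theorem measurePreserving_splitEquiv (I : Set ℝ) {k l n : ℕ} (e : Fin k ⊕ Fin l ≃ Fin n) :
    MeasurePreserving (splitEquiv e) (configMeasure I n)
      ((configMeasure I k).prod (configMeasure I l)) :=
  (measurePreserving_sumPiEquivProdPi fun _ : Fin k ⊕ Fin l => (volume.restrict I)).comp
    (measurePreserving_piCongrLeft (fun _ : Fin n => volume.restrict I) e).symm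

/-- The convolution of two functions of finite sets of points. -/
def splitSum (F G : Finset ℝ → ℂ) (s : Finset ℝ) : ℂ := ∑ t ∈ s.powerset, F t * G (s \ t)

/-- Injectivity makes index subsets correspond bijectively to subsets of points, with complements
matching. -/
theorem splitSum_points {ι : Type*} [Fintype ι] [DecidableEq ι] (F G : Finset ℝ → ℂ) {x : ι → ℝ}
    (hx : Function.Injective x) :
    splitSum F G (points x) = ∑ A : Finset ι, F (A.image x) * G (Aᶜ.image x) := by
  have h : (points x).powerset = (Finset.univ : Finset (Finset ι)).image (Finset.image x) := by
    ext t
    simp [points, Finset.subset_image_iff]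
  rw [splitSum, h, Finset.sum_image fun A _ A' _ h => Finset.image_injective hx h]
  refine Finset.sum_congr rfl fun A _ => ?_
  rw [points, ← Finset.image_sdiff _ _ hx, Finset.compl_eq_univ_sdiff]

/-- The coordinates in `A` and in `Aᶜ` are separate factors of the product measure; enumerating each
block increasingly turns it into a standard configuration, so Fubini applies. -/
theorem integrable_integral_split {I : Set ℝ} {F G : Finset ℝ → ℂ}
    (hF : ∀ n, Integrable (fun x : Fin n → ℝ => F (points x)) (configMeasure I n))
    (hG : ∀ n, Integrable (fun x : Fin n → ℝ => G (points x)) (configMeasure I n))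
    {n : ℕ} (A : Finset (Fin n)) :
    Integrable (fun x => F (A.image x) * G (Aᶜ.image x)) (configMeasure I n) ∧
    ∫ x, F (A.image x) * G (Aᶜ.image x) ∂configMeasure I n =
      (∫ x, F (points x) ∂configMeasure I A.card) *
        ∫ x, G (points x) ∂configMeasure I (n - A.card) := by
  let e := finSumEquivOfFinset (s := A) (m := A.card) (n := n - A.card) rfl
    (by rw [Finset.card_compl, Fintype.card_fin])
  have he : (fun x : Fin n → ℝ => F (A.image x) * G (Aᶜ.image x)) =
      (fun z : (Fin A.card → ℝ) × (Fin (n - A.card) → ℝ) => F (points z.1) * G (points z.2)) ∘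
        splitEquiv e := by
    funext x
    have h1 : x ∘ e ∘ Sum.inl = x ∘ A.orderEmbOfFin rfl := by
      ext i
      simp [e]
    have h2 : x ∘ e ∘ Sum.inr =
        x ∘ Aᶜ.orderEmbOfFin (by rw [Finset.card_compl, Fintype.card_fin]) := by
      ext i
      simp [e]
    simp [splitEquiv_apply, h1, h2, points_comp_orderEmbOfFin]
  have hp := measurePreserving_splitEquiv I e
  rw [he]
  refine ⟨(hp.integrable_comp_emb (splitEquiv e).measurableEmbedding).2
    ((hF _).mul_prod (hG _)), ?_⟩
  exact (hp.integral_comp (splitEquiv e).measurableEmbedding _).trans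
    (integral_prod_mul (fun x => F (points x)) (fun x => G (points x)))

theorem integrable_splitSum {I : Set ℝ} {F G : Finset ℝ → ℂ}
    (hF : ∀ n, Integrable (fun x : Fin n → ℝ => F (points x)) (configMeasure I n))
    (hG : ∀ n, Integrable (fun x : Fin n → ℝ => G (points x)) (configMeasure I n)) (n : ℕ) :
    Integrable (fun x : Fin n → ℝ => splitSum F G (points x)) (configMeasure I n) := by
  refine (integrable_finsetSum Finset.univ fun A _ =>
    (integrable_integral_split hF hG A).1).congr ?_
  filter_upwards [ae_injective I n] with x hx
  rw [splitSum_points F G hx]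

theorem integral_splitSum {I : Set ℝ} {F G : Finset ℝ → ℂ}
    (hF : ∀ n, Integrable (fun x : Fin n → ℝ => F (points x)) (configMeasure I n))
    (hG : ∀ n, Integrable (fun x : Fin n → ℝ => G (points x)) (configMeasure I n)) (n : ℕ) :
    ∫ x, splitSum F G (points x) ∂configMeasure I n =
      ∑ k ∈ Finset.range (n + 1), n.choose k • ((∫ x, F (points x) ∂configMeasure I k) *
        ∫ x, G (points x) ∂configMeasure I (n - k)) := by
  have h : (fun x : Fin n → ℝ => splitSum F G (points x)) =ᵐ[configMeasure I n]
      fun x => ∑ A : Finset (Fin n), F (A.image x) * G (Aᶜ.image x) := by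
    filter_upwards [ae_injective I n] with x hx
    rw [splitSum_points F G hx]
  -- Each term depends only on `A.card`, so grouping by cardinality produces the binomial
  -- coefficients.
  rw [integral_congr_ae h, integral_finsetSum _ fun A _ => (integrable_integral_split hF hG A).1,
    Finset.sum_congr rfl fun A _ => (integrable_integral_split hF hG A).2, ← Finset.powerset_univ,
    Finset.sum_powerset_apply_card (fun k => (∫ x, F (points x) ∂configMeasure I k) *
        ∫ x, G (points x) ∂configMeasure I (n - k)), Finset.card_univ, Fintype.card_fin]

theorem integral_orderedSimplex_splitSum {I : Set ℝ} {F G : Finset ℝ → ℂ}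
    (hF : ∀ n, Integrable (fun x : Fin n → ℝ => F (points x)) (configMeasure I n))
    (hG : ∀ n, Integrable (fun x : Fin n → ℝ => G (points x)) (configMeasure I n)) (n : ℕ) :
    ∫ x in orderedSimplex n, splitSum F G (points x) ∂configMeasure I n =
      ∑ k ∈ Finset.range (n + 1), (∫ x in orderedSimplex k, F (points x) ∂configMeasure I k) *
        ∫ x in orderedSimplex (n - k), G (points x) ∂configMeasure I (n - k) := by
  have h := integral_splitSum hF hG n
  rw [integral_points_eq_factorial_mul (integrable_splitSum hF hG n)] at h
  have hn : (n.factorial : ℂ) ≠ 0 := by exact_mod_cast n.factorial_ne_zero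
  refine mul_left_cancel₀ hn (h.trans ?_)
  rw [Finset.mul_sum]
  refine Finset.sum_congr rfl fun k hk => ?_
  rw [integral_points_eq_factorial_mul (hF k), integral_points_eq_factorial_mul (hG (n - k)),
    ← Nat.choose_mul_factorial_mul_factorial (Nat.lt_succ_iff.1 (Finset.mem_range.1 hk))]
  push_cast
  rw [nsmul_eq_mul]
  ring

/-! ### Path-ordered products over finite sets of points -/

section PathProduct

variable {ι V : Type} [Fintype ι] [DecidableEq ι] [AddCommGroup V] [Module ℂ V]

/-- The product of `𝔏` over a finite set of points, in increasing order. -/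
def pathProduct (𝔏 : ℝ → Matrix ι ι (Module.End ℂ V)) (s : Finset ℝ) :
    Matrix ι ι (Module.End ℂ V) :=
  (s.sort.map 𝔏).prod

theorem orderedProduct_eq_pathProduct (𝔏 : ℝ → Matrix ι ι (Module.End ℂ V)) {n : ℕ}
    {x : Fin n → ℝ} (hx : x ∈ orderedSimplex n) :
    orderedProduct 𝔏 x = pathProduct 𝔏 (points x) := by
  rw [pathProduct, sort_points_of_strictMono hx, List.map_ofFn]
  rfl

@[simp]
theorem pathProduct_empty (𝔏 : ℝ → Matrix ι ι (Module.End ℂ V)) : pathProduct 𝔏 ∅ = 1 := by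
  simp [pathProduct]

theorem pathProduct_insert (𝔏 : ℝ → Matrix ι ι (Module.End ℂ V)) {m : ℝ} {s : Finset ℝ}
    (hm : ∀ x ∈ s, m < x) : pathProduct 𝔏 (insert m s) = 𝔏 m * pathProduct 𝔏 s := by
  rw [pathProduct, Finset.sort_insert _ (fun x hx => (hm x hx).le)
    fun h => lt_irrefl _ (hm m h), List.map_cons, List.prod_cons]
  rfl

/-- Replaces the integrand by a symmetric one agreeing with it on the simplex, so that integrability
can be stated over all configurations. -/
theorem hasPathExp_iff {I : Set ℝ} {B : Matrix ι ι ℂ} {𝔏 : ℝ → Matrix ι ι (Module.End ℂ V)}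
    {v : V} {ev : V → ℂ} {z : ℂ} :
    HasPathExp I B 𝔏 v ev z ↔
      (∀ n : ℕ, Integrable (fun x : Fin n → ℝ =>
        ev (auxTrace B (pathProduct 𝔏 (points x)) v)) (configMeasure I n)) ∧
      HasSum (fun n : ℕ => ∫ x in orderedSimplex n,
        ev (auxTrace B (pathProduct 𝔏 (points x)) v) ∂(configMeasure I n)) z := by
  have h (n : ℕ) : Set.EqOn (fun x : Fin n → ℝ => ev (auxTrace B (orderedProduct 𝔏 x) v))
      (fun x => ev (auxTrace B (pathProduct 𝔏 (points x)) v)) (orderedSimplex n) := by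
    intro x hx
    simp only [orderedProduct_eq_pathProduct 𝔏 hx]
  unfold HasPathExp
  simp only [integrableOn_congr_fun (h _) (measurableSet_orderedSimplex _),
    setIntegral_congr_fun (measurableSet_orderedSimplex _) (h _),
    integrable_points_iff (F := fun s => ev (auxTrace B (pathProduct 𝔏 s) v))]

theorem hasPathExp_reindex {κ : Type} [Fintype κ] [DecidableEq κ] (e : ι ≃ κ) {I : Set ℝ}
    {B : Matrix ι ι ℂ} {𝔏 : ℝ → Matrix ι ι (Module.End ℂ V)} {v : V} {ev : V → ℂ} {z : ℂ}
    (h : HasPathExp I B 𝔏 v ev z) :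
    HasPathExp I (Matrix.reindex e e B) (fun x => Matrix.reindex e e (𝔏 x)) v ev z := by
  have hprod {n : ℕ} (x : Fin n → ℝ) : orderedProduct (fun x => Matrix.reindex e e (𝔏 x)) x =
      Matrix.reindex e e (orderedProduct 𝔏 x) := by
    have := map_list_prod (Matrix.reindexRingEquiv (Module.End ℂ V) e)
      (List.ofFn fun k => 𝔏 (x k))
    rw [List.map_ofFn] at this
    exact this.symm
  have htr (M : Matrix ι ι (Module.End ℂ V)) :
      auxTrace (Matrix.reindex e e B) (Matrix.reindex e e M) = auxTrace B M := by
    simp only [auxTrace, Matrix.reindex_apply, Matrix.submatrix_apply]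
    rw [← e.sum_comp]
    refine Finset.sum_congr rfl fun a _ => ?_
    rw [← e.sum_comp]
    simp
  simpa only [HasPathExp, hprod, htr] using h

end PathProduct

/-! ### Products of generalized states -/

/-- The generalized operator `|v⟩⟨w|`. -/
def ketBra : Ket →ₗ[ℂ] Ket →ₗ⋆[ℂ] FormOp :=
  LinearMap.mk₂'ₛₗ (RingHom.id ℂ) (starRingEnd ℂ) (fun v w Φ Χ => v Φ * star (w Χ))
    (fun _ _ _ => by ext; simp [add_mul]) (fun _ _ _ => by ext; simp [mul_assoc])
    (fun _ _ _ => by ext; simp [mul_add]) (fun _ _ _ => by ext; simp [mul_left_comm])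

theorem ketBra_apply (v w : Ket) (Φ Χ : Wave) : ketBra v w Φ Χ = v Φ * star (w Χ) := rfl

theorem vacuumProj_eq_ketBra : vacuumProj = ketBra vacuumKet vacuumKet := by
  ext Φ Χ
  simp [ketBra_apply, vacuumProj, vacuumKet]

@[simp]
theorem leftMap_ketBra (x : ℝ) (v w : Ket) : leftMap x (ketBra v w) = ketBra (create x v) w := rfl

@[simp]
theorem rightMap_ketBra (x : ℝ) (v w : Ket) : rightMap x (ketBra v w) = ketBra v (create x w) := rfl

section Tensor

variable {ι κ : Type} [Fintype ι] [DecidableEq ι] [Fintype κ] [DecidableEq κ]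

/-- The generator of the tensor product of the cMPS with tensors `(Qi, Li)` and the conjugate of
the cMPS with tensors `(Qj, Lj)`. -/
def ketBraGenerator (Qi Li : ℝ → Matrix ι ι ℂ) (Qj Lj : ℝ → Matrix κ κ ℂ) :
    ℝ → Matrix (ι × κ) (ι × κ) (Module.End ℂ FormOp) :=
  operatorGenerator
    (fun x => Qi x ⊗ₖ (1 : Matrix κ κ ℂ) + (1 : Matrix ι ι ℂ) ⊗ₖ (Qj x).map star)
    (fun x => Li x ⊗ₖ (1 : Matrix κ κ ℂ))
    (fun x => (1 : Matrix ι ι ℂ) ⊗ₖ (Lj x).map star)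
    (fun _ => 0)

omit [Fintype ι] [Fintype κ] in
-- A Leibniz rule. The conjugated tensors become the plain generator of `w` because `ketBra` is
-- conjugate-linear in the bra.
theorem ketBraGenerator_apply_ketBra (Qi Li : ℝ → Matrix ι ι ℂ) (Qj Lj : ℝ → Matrix κ κ ℂ) (x : ℝ)
    (a c : ι) (b d : κ) (v w : Ket) :
    ketBraGenerator Qi Li Qj Lj x (a, b) (c, d) (ketBra v w) =
      (if b = d then ketBra (stateGenerator Qi Li x a c v) w else 0) +
      (if a = c then ketBra v (stateGenerator Qj Lj x b d w) else 0) := by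
  by_cases hbd : b = d <;> by_cases hac : a = c <;>
    simp [ketBraGenerator, operatorGenerator, stateGenerator, Matrix.one_apply, hbd, hac, add_smul]
  abel

theorem pathProduct_ketBraGenerator (Qi Li : ℝ → Matrix ι ι ℂ) (Qj Lj : ℝ → Matrix κ κ ℂ)
    (s : Finset ℝ) (a c : ι) (b d : κ) (v w : Ket) :
    pathProduct (ketBraGenerator Qi Li Qj Lj) s (a, b) (c, d) (ketBra v w) =
      ∑ t ∈ s.powerset, ketBra (pathProduct (stateGenerator Qi Li) t a c v)
        (pathProduct (stateGenerator Qj Lj) (s \ t) b d w) := by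
  -- The smallest point is the leftmost factor, hence acts last, on the rank-one terms supplied by
  -- the induction hypothesis.
  induction s using Finset.induction_on_min generalizing a b with
  | empty =>
    by_cases hbd : b = d <;> by_cases hac : a = c <;> simp [hbd, hac]
  | insert m s hm ih =>
    have hms : m ∉ s := fun h => lt_irrefl _ (hm m h)
    rw [Finset.sum_powerset_insert hms, pathProduct_insert _ hm, Matrix.mul_apply,
      ← Finset.sum_add_distrib, Fintype.sum_prod_type]
    simp only [LinearMap.sum_apply, Module.End.mul_apply, ih, map_sum,
      ketBraGenerator_apply_ketBra]
    simp only [Finset.sum_add_distrib, Finset.sum_ite_irrel, Finset.sum_const_zero,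
      Finset.sum_ite_eq, Finset.mem_univ, if_true]
    -- Subsets of `insert m s` avoiding `m` are those where `m` acts on the bra; those containing
    -- it, where it acts on the ket.
    rw [add_comm]
    congr 1
    · rw [Finset.sum_comm]
      refine Finset.sum_congr rfl fun t ht => ?_
      have hts := Finset.mem_powerset.1 ht
      rw [Finset.insert_sdiff_of_notMem _ fun h => hms (hts h),
        pathProduct_insert _ fun x hx => hm x (Finset.mem_sdiff.1 hx).1, Matrix.mul_apply]
      simp only [LinearMap.sum_apply, Module.End.mul_apply, map_sum]
    · rw [Finset.sum_comm]
      refine Finset.sum_congr rfl fun t ht => ?_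
      have hts := Finset.mem_powerset.1 ht
      rw [Finset.insert_sdiff_insert, Finset.sdiff_insert_of_notMem hms,
        pathProduct_insert _ fun x hx => hm x (hts hx), Matrix.mul_apply]
      simp only [LinearMap.sum_apply, Module.End.mul_apply, map_sum]

theorem auxTrace_ketBraGenerator (Bi : Matrix ι ι ℂ) (Qi Li : ℝ → Matrix ι ι ℂ)
    (Bj : Matrix κ κ ℂ) (Qj Lj : ℝ → Matrix κ κ ℂ) (s : Finset ℝ) (v w : Ket) :
    auxTrace (Bi ⊗ₖ Bj.map star) (pathProduct (ketBraGenerator Qi Li Qj Lj) s) (ketBra v w) =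
      ∑ t ∈ s.powerset, ketBra (auxTrace Bi (pathProduct (stateGenerator Qi Li) t) v)
        (auxTrace Bj (pathProduct (stateGenerator Qj Lj) (s \ t)) w) := by
  simp only [auxTrace, LinearMap.sum_apply, LinearMap.smul_apply, map_sum, map_smulₛₗ,
    Fintype.sum_prod_type, pathProduct_ketBraGenerator, Matrix.kroneckerMap_apply, Matrix.map_apply,
    Finset.smul_sum]
  simp_rw [Finset.sum_comm (t := s.powerset)]
  refine Finset.sum_congr rfl fun t _ => Finset.sum_comm.trans ?_
  refine Finset.sum_congr rfl fun b _ => ?_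
  refine (Finset.sum_congr rfl fun a _ => Finset.sum_comm).trans (Finset.sum_comm.trans ?_)
  refine Finset.sum_congr rfl fun d _ => Finset.sum_congr rfl fun a _ =>
    Finset.sum_congr rfl fun c _ => ?_
  rw [smul_smul, mul_comm]
  rfl

end Tensor

/-! ### Rank-one operators as continuous matrix product operators -/

theorem IsCMPSWith.isCMPOWith_rankOne {ι κ : Type} [Fintype ι] [DecidableEq ι] [Fintype κ]
    [DecidableEq κ] {I : Set ℝ} {Bi : Matrix ι ι ℂ} {Qi Li : ℝ → Matrix ι ι ℂ}
    {Bj : Matrix κ κ ℂ} {Qj Lj : ℝ → Matrix κ κ ℂ} {ψi ψj : Fock I}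
    (hi : IsCMPSWith I Bi Qi Li ψi) (hj : IsCMPSWith I Bj Qj Lj ψj) :
    IsCMPOWith I (Bi ⊗ₖ Bj.map star)
      (fun x => Qi x ⊗ₖ (1 : Matrix κ κ ℂ) + (1 : Matrix ι ι ℂ) ⊗ₖ (Qj x).map star)
      (fun x => Li x ⊗ₖ (1 : Matrix κ κ ℂ))
      (fun x => (1 : Matrix ι ι ℂ) ⊗ₖ (Lj x).map star)
      (fun _ => 0) (InnerProductSpace.rankOne ℂ ψi ψj) := by
  intro Φ Χ hΦ hΧ
  obtain ⟨hF, hFsum⟩ := hasPathExp_iff.1 (hi Φ hΦ)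
  obtain ⟨hG', hGsum'⟩ := hasPathExp_iff.1 (hj Χ hΧ)
  let F : Finset ℝ → ℂ := fun s =>
    auxTrace Bi (pathProduct (stateGenerator Qi Li) s) vacuumKet (wave Φ)
  let G : Finset ℝ → ℂ := fun s =>
    star (auxTrace Bj (pathProduct (stateGenerator Qj Lj) s) vacuumKet (wave Χ))
  have hG (n : ℕ) : Integrable (fun x : Fin n → ℝ => G (points x)) (configMeasure I n) :=
    Complex.conjCLE.toContinuousLinearMap.integrable_comp (hG' n)
  have hGsum : HasSum (fun n : ℕ => ∫ x in orderedSimplex n, G (points x) ∂configMeasure I n)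
      (inner ℂ ψj Χ) := by
    rw [← inner_conj_symm]
    have h := hGsum'.star
    simp only [← starRingEnd_apply, ← integral_conj] at h
    exact h
  have hFG (s : Finset ℝ) : auxTrace (Bi ⊗ₖ Bj.map star)
      (pathProduct (ketBraGenerator Qi Li Qj Lj) s) vacuumProj (wave Φ) (wave Χ) =
        splitSum F G s := by
    rw [vacuumProj_eq_ketBra, auxTrace_ketBraGenerator]
    simp only [Finset.sum_apply, ketBra_apply, splitSum, F, G]
  refine hasPathExp_iff.2 ?_
  change (∀ n : ℕ, Integrable (fun x : Fin n → ℝ => auxTrace (Bi ⊗ₖ Bj.map star)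
      (pathProduct (ketBraGenerator Qi Li Qj Lj) (points x)) vacuumProj (wave Φ) (wave Χ))
      (configMeasure I n)) ∧
    HasSum (fun n : ℕ => ∫ x in orderedSimplex n, auxTrace (Bi ⊗ₖ Bj.map star)
      (pathProduct (ketBraGenerator Qi Li Qj Lj) (points x)) vacuumProj (wave Φ) (wave Χ)
      ∂configMeasure I n) _
  simp only [hFG]
  refine ⟨integrable_splitSum hF hG, ?_⟩
  simp only [integral_orderedSimplex_splitSum (F := F) hF hG]
  -- Summability in `ℂ` is absolute, which is what the Cauchy product of the two series requires.
  rw [InnerProductSpace.rankOne_apply, inner_smul_right, mul_comm, ← hFsum.tsum_eq,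
    ← hGsum.tsum_eq,
    tsum_mul_tsum_eq_tsum_sum_range_of_summable_norm hFsum.summable.norm hGsum.summable.norm]
  exact (summable_norm_sum_mul_range_of_summable_norm
    hFsum.summable.norm hGsum.summable.norm).of_norm.hasSum

theorem IsCMPOWith.isCMPO {ι : Type} [Fintype ι] [DecidableEq ι] {I : Set ℝ} {D : ℕ}
    {B : Matrix ι ι ℂ} {Q L R T : ℝ → Matrix ι ι ℂ} {O : Fock I →L[ℂ] Fock I}
    (h : IsCMPOWith I B Q L R T O) (hD : Fintype.card ι = D) : IsCMPO I D O := by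
  let e := Fintype.equivFinOfCardEq hD
  exact ⟨Matrix.reindex e e B, fun x => Matrix.reindex e e (Q x), fun x => Matrix.reindex e e (L x),
    fun x => Matrix.reindex e e (R x), fun x => Matrix.reindex e e (T x),
    -- The generator is built entrywise, so reindexing its tensors reindexes it definitionally.
    fun Φ Χ hΦ hΧ => hasPathExp_reindex e (h Φ Χ hΦ hΧ)⟩

end ContinuousMPO

end

theorem mainTheorem4 (I : Set ℝ) (hI : I.OrdConnected) (Di Dj : ℕ)
    (Bi : Matrix (Fin Di) (Fin Di) ℂ) (Qi Li : ℝ → Matrix (Fin Di) (Fin Di) ℂ)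
    (Bj : Matrix (Fin Dj) (Fin Dj) ℂ) (Qj Lj : ℝ → Matrix (Fin Dj) (Fin Dj) ℂ)
    (ψi ψj : ContinuousMPO.Fock I)
    (hi : ContinuousMPO.IsCMPSWith I Bi Qi Li ψi) (hj : ContinuousMPO.IsCMPSWith I Bj Qj Lj ψj)
    (hi_norm : ‖ψi‖ = 1) (hj_norm : ‖ψj‖ = 1) :
    ContinuousMPO.IsCMPO I (Di * Dj) (InnerProductSpace.rankOne ℂ ψi ψj) ∧
    ContinuousMPO.IsCMPOWith I
      (Bi ⊗ₖ Bj.map star)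
      (fun x => Qi x ⊗ₖ (1 : Matrix (Fin Dj) (Fin Dj) ℂ)
        + (1 : Matrix (Fin Di) (Fin Di) ℂ) ⊗ₖ (Qj x).map star)
      (fun x => Li x ⊗ₖ (1 : Matrix (Fin Dj) (Fin Dj) ℂ))
      (fun x => (1 : Matrix (Fin Di) (Fin Di) ℂ) ⊗ₖ (Lj x).map star)
      (fun _ => 0)
      (InnerProductSpace.rankOne ℂ ψi ψj) ∧
    ContinuousMPO.IsCMPO I (Di ^ 2) (Submodule.span ℂ {ψi}).starProjection := by
  have h := hi.isCMPOWith_rankOne hj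
  refine ⟨h.isCMPO (by simp), h, ?_⟩
  have hproj : (Submodule.span ℂ {ψi}).starProjection = InnerProductSpace.rankOne ℂ ψi ψi := by
    ext1 Φ
    rw [InnerProductSpace.rankOne_apply]
    exact Submodule.starProjection_unit_singleton ℂ hi_norm Φ
  rw [hproj]
  exact (hi.isCMPOWith_rankOne hi).isCMPO (by simp [sq])
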